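/- Let $X$ be a finite set of points, $\mathcal C$ a finite nonempty set of candidate centers, $k\ge 1$ an integer, and $d: X\times\mathcal C\to[0,\infty)$ a distance function obeying the relaxed 3-hop triangle inequality $$d(x,c)\le 3\big(d(x,c')+d(x',c')+d(x',c)\big)\qquad\text{for all }x,x'\in X,\ c,c'\in\mathcal C .$$ The cost of a nonempty set $S\subseteq\mathcal C$ is $\mathrm{cost}(S)=\sum_{x\in X}\min_{c\in S}d(x,c)$. The $k$-median LP is to minimize $\sum_{c}\sum_{x} z_{xc}\,d(x,c)$ subject to $\sum_c y_c=k$; $\sum_c z_{xc}=1$ for all $x$; $z_{xc}\le y_c$ for all $x,c$; $z_{xc},y_c\ge 0$. Let $LP$ be its optimal value and, for a solution, let $R_x=\sum_c z_{xc}\,d(x,c)$ be the LP radius of $x$. For a parameter $\beta>1$ such that $\beta k$ is an integer, consider the following randomized LP-rounding algorithm. 1. Take an optimal LP solution $(y,z)$. Split every center $c$ into finitely many co-located copies $p$ with positive weights $y_p$ of total $y_c$, so that each point $x$ is served by a set $C_x$ of copies, each used with its full weight: for every center $c$, the copies of $c$ in $C_x$ have total weight $z_{xc}$. The splitting has to be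 fine enough for the sets of prescribed weight in the next steps to exist. 2. For every $x\in X$, let $B_x$ be a ball around $x$ of weight exactly $1/\beta$: a set of copies of total weight $1/\beta$ such that no copy in $B_x$ is farther from $x$ than a copy outside $B_x$. 3. Go through the points in ascending order of $R_x$ (ties broken arbitrarily) and choose $x$ if and only if $B_x$ is disjoint from all balls chosen before. The witness of a chosen point is the point itself, and the witness of any other point $x$ is the first chosen $x'$ whose ball $B_{x'}$ intersects $B_x$. 4. Partition all the copies into groups of weight $1/\beta$ so that all the chosen balls are groups (the other groups are arbitrary). 5. Independently in each group, pick one copy $p$ of the group, with probability $\beta y_p$. Output the set $S$ of the centers whose copies are picked, and assign every point to its closest center in $S$. Let $$\alpha(\beta)=1+e^{-\beta}\Big(\frac{6\beta}{\beta-1}+\frac{(\beta-1)^2}{\beta}\Big).$$ Then, for every $\beta>1$, the following holds for the algorithm run with the parameter $\beta'=\lceil\beta k\rceil/k$ (so $\beta'=\beta$ whenever $\beta k$ is an integer). The LP has an optimal solution, and from each optimal LP solution the algorithm can be executed. In every execution, whatever the arbitrary choices in steps 1-4, there are exactly $\lceil\beta k\rceil$ groups, so that one center is picked from each of $\lceil\beta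 k\rceil$ groups; the output $S$ is a nonempty set of at most $\lceil\beta k\rceil$ distinct centers (copies picked in different groups may be co-located); and $$\mathbb E[\mathrm{cost}(S)]\le\alpha(\beta)\cdot LP .$$ Consequently $\mathbb E[\mathrm{cost}(S)]\le\alpha(\beta)\cdot\mathrm{cost}(S^*)$ for every nonempty $S^*\subseteq\mathcal C$ with $|S^*|\le k$; that is, the algorithm is a $(\beta,\alpha(\beta))$ bi-criteria approximation algorithm for such $k$-median instances. -/

import Mathlib

open scoped BigOperators
open MeasureTheory

/-- An instance of the `k`-median problem with a finite set of points `X`, a finite set of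
candidate centers `C`, and point-to-center distances obeying the relaxed 3-hop triangle
inequality: going from `x` to `c` through a center `c'` and a point `x'` costs at least one third
of the direct distance. -/
structure RelaxedKMedian (X C : Type*) where
  k : ℕ
  k_pos : 0 < k
  d : X → C → ℝ
  d_nonneg : ∀ x c, 0 ≤ d x c
  relaxed_triangle : ∀ x c' x' c, d x c ≤ 3 * (d x c' + d x' c' + d x' c)

namespace RelaxedKMedian

variable {X C : Type*} [Fintype X] [Fintype C]

/-- Distance from a point to the closest center of `S` (meaningful for nonempty `S`). -/
noncomputable def distTo (I : RelaxedKMedian X C) (x : X) (S : Finset C) : ℝ :=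
  ⨅ c : S, I.d x c

/-- The `k`-median cost of opening the centers in `S`: every point goes to its closest center. -/
noncomputable def cost (I : RelaxedKMedian X C) (S : Finset C) : ℝ :=
  ∑ x, I.distTo x S

/-- Feasible solutions of the standard linear programming relaxation. -/
structure LPFeasible (I : RelaxedKMedian X C) (y : C → ℝ) (z : X → C → ℝ) : Prop where
  sum_y : ∑ c, y c = I.k
  sum_z : ∀ x, ∑ c, z x c = 1
  z_le_y : ∀ x c, z x c ≤ y c
  y_nonneg : ∀ c, 0 ≤ y c
  z_nonneg : ∀ x c, 0 ≤ z x c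

/-- The LP radius `R_x` of a point. -/
def lpRadius (I : RelaxedKMedian X C) (z : X → C → ℝ) (x : X) : ℝ :=
  ∑ c, z x c * I.d x c

/-- The objective function of the linear program. -/
def lpObjective (I : RelaxedKMedian X C) (z : X → C → ℝ) : ℝ :=
  ∑ c, ∑ x, z x c * I.d x c

/-- Optimal solutions of the linear program. -/
def LPOptimal (I : RelaxedKMedian X C) (y : C → ℝ) (z : X → C → ℝ) : Prop :=
  I.LPFeasible y z ∧ ∀ y' z', I.LPFeasible y' z' → I.lpObjective z ≤ I.lpObjective z'

/-- An execution of the rounding algorithm with parameter `β` on the LP solution `(y, z)`, up to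
(and not including) the random selection of centers. All choices that the algorithm leaves
arbitrary (the way centers are split, the ties in the order and on the boundary of the balls, the
grouping of the centers outside the chosen balls) are arbitrary here. -/
structure Execution [DecidableEq C] (I : RelaxedKMedian X C) (β : ℝ) (y : C → ℝ) (z : X → C → ℝ) where
  one_lt_beta : 1 < β
  /-- The centers are split into `n` co-located copies of positive LP weight:
  the copy `p` sits at the center `loc p` and has weight `wt p`. -/
  n : ℕ
  loc : Fin n → C
  wt : Fin n → ℝ
  wt_pos : ∀ p, 0 < wt p
  sum_wt : ∀ c, ∑ p with loc p = c, wt p = y c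
  /-- The copies that serve the point `x`; each of them serves `x` with its full weight. -/
  serve : X → Finset (Fin n)
  sum_serve : ∀ x c, ∑ p ∈ serve x with loc p = c, wt p = z x c
  /-- The ball around `x` of LP weight exactly `1 / β`: it consists of copies that are closest to
  `x`, and contains an arbitrary part of the copies on its boundary. -/
  ball : X → Finset (Fin n)
  ball_weight : ∀ x, ∑ p ∈ ball x, wt p = 1 / β
  ball_closest : ∀ x, ∀ p ∈ ball x, ∀ q ∉ ball x, I.d x (loc p) ≤ I.d x (loc q)
  /-- The points are processed in ascending order of the LP radius. -/
  order : Fin (Fintype.card X) ≃ X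
  order_mono : Monotone fun i => I.lpRadius z (order i)
  /-- The greedily chosen points: `x` is chosen if and only if its ball is disjoint from the balls
  of all the points chosen before it. -/
  chosen : Set X
  mem_chosen_iff : ∀ x, x ∈ chosen ↔
    ∀ x' ∈ chosen, order.symm x' < order.symm x → Disjoint (ball x) (ball x')
  /-- The witness of a chosen point is the point itself; the witness of a discarded point is the
  first chosen point whose ball intersects its ball. -/
  witness : X → X
  witness_of_chosen : ∀ x ∈ chosen, witness x = x
  witness_of_discarded : ∀ x ∉ chosen,
    witness x ∈ chosen ∧ ¬ Disjoint (ball x) (ball (witness x)) ∧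
      ∀ x' ∈ chosen, ¬ Disjoint (ball x) (ball x') → order.symm (witness x) ≤ order.symm x'
  /-- The partition of all copies into groups of LP weight `1 / β`. -/
  groups : Finpartition (Finset.univ : Finset (Fin n))
  group_weight : ∀ g ∈ groups.parts, ∑ p ∈ g, wt p = 1 / β
  ball_mem_groups : ∀ x ∈ chosen, ball x ∈ groups.parts

namespace Execution

variable [DecidableEq C] {I : RelaxedKMedian X C} {β : ℝ} {y : C → ℝ} {z : X → C → ℝ}

/-- The random choice made in the group `g`: the copy `p ∈ g` is picked with probability
`β * wt p`. -/
noncomputable def pick (E : I.Execution β y z) (g : E.groups.parts) : PMF (Fin E.n) :=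
  PMF.ofFintype (fun p => if p ∈ g.1 then ENNReal.ofReal (β * E.wt p) else 0) (by
    have hβ : 0 < β := zero_lt_one.trans E.one_lt_beta
    rw [← Finset.sum_filter, Finset.filter_mem_eq_inter, Finset.univ_inter,
      ← ENNReal.ofReal_sum_of_nonneg (fun p _ => (mul_pos hβ (E.wt_pos p)).le),
      ← Finset.mul_sum, E.group_weight g.1 g.2, mul_one_div_cancel hβ.ne', ENNReal.ofReal_one])

/-- The joint law of the picks: one copy is picked in each group, independently. -/
noncomputable def law (E : I.Execution β y z) : Measure (E.groups.parts → Fin E.n) :=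
  Measure.pi fun g => (E.pick g).toMeasure

/-- The set of centers that is output when the copy `s g` is picked in each group `g`. -/
def output (E : I.Execution β y z) (s : E.groups.parts → Fin E.n) : Finset C :=
  Finset.univ.image fun g => E.loc (s g)

/-- The expected cost of the output. -/
noncomputable def expectedCost (E : I.Execution β y z) : ℝ :=
  ∫ s, I.cost (E.output s) ∂E.law

end Execution

end RelaxedKMedian

/-- The approximation factor of the algorithm. -/
noncomputable def approxFactor (β : ℝ) : ℝ :=
  1 + Real.exp (-β) * (6 * β / (β - 1) + (β - 1) ^ 2 / β)

/-!
Throughout, `β` is the parameter of the execution; the theorem uses the parameter `⌈β * k⌉₊ / k`.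
The LP attains its optimum by compactness (`exists_LPOptimal`), and a set of at most `k` centers is
a feasible solution of the same cost (`LPOptimal.lpObjective_le_cost`). Every center can be split so
that its serving sets and its shares of the (greedily filled) balls become sets of copies
(`exists_split`); after the greedy choice of balls, the copies outside the chosen balls are split
once more, each of them equally among the missing groups (`exists_split_groups`). So the algorithm
can be executed (`nonempty_execution`). A group has weight `1 / β` and all copies together have
weight `k`, hence there are `β * k` groups (`card_groups`).

For the cost, fix a point `x` of LP radius `R`. Let `q g` be the probability that the pick in the
group `g` is a copy serving `x`; these probabilities add up to `β`. Rank the groups by the average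
distance of their serving copies and send `x` to the pick of the first group that hits one. The
probability that this is the group `g` is `q g` times a factor that decreases along the ranking, so
Chebyshev's sum inequality (`sum_mul_mul_sum_le`) bounds the contribution of the hits by
`(1 - P) * R`, where `P = ∏ g, (1 - q g)` is the probability that nothing is hit.

If nothing is hit, `x` goes to the pick `p` in the ball of its witness `x'`, at a distance of at
most `3 * (r + r' + d(x', p))`, with `r`, `r'` the radii of the two balls. A ball has weight `1 / β`
and a point is served with weight `1`, so the radius of a ball and the average distance in it
together are controlled by the LP radius (`exists_ball_radius`), and the radius of the witness is at
most `R`. The event that nothing is hit is not independent of `p`: given `u = q g` for the ball `g`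
of the witness, the other groups miss with probability at most `exp (u - β)`. The resulting
inequality in `u` and `β` is `excess_le`. Summing over the points gives the factor
`approxFactor β` for every execution with parameter `β` (`expectedCost_le`). Rounding `β * k` up
only increases the parameter, and `approxFactor` is decreasing (`approxFactor_antitone`).
-/


/-! ### Real inequalities -/

lemma approxFactor_eq {β : ℝ} (hβ : 1 < β) :
    approxFactor β = 1 + Real.exp (-β) * (β + 4 + 1 / β + 6 / (β - 1)) := by
  have h1 : β - 1 ≠ 0 := by linarith
  have h2 : β ≠ 0 := by linarith
  unfold approxFactor
  field_simp
  ring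

lemma approxFactor_nonneg {β : ℝ} (hβ : 1 < β) : 0 ≤ approxFactor β := by
  have h1 : 0 < β - 1 := by linarith
  have h2 : 0 < β := by linarith
  unfold approxFactor
  positivity

lemma approxFactor_antitone {β β' : ℝ} (hβ : 1 < β) (h : β ≤ β') :
    approxFactor β' ≤ approxFactor β := by
  rw [approxFactor_eq hβ, approxFactor_eq (hβ.trans_le h)]
  have h1 : 1 / β' ≤ 1 / β := one_div_le_one_div_of_le (by linarith) h
  have h2 : 6 / (β' - 1) ≤ 6 / (β - 1) :=
    div_le_div_of_nonneg_left (by norm_num) (by linarith) (by linarith)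
  have h3 : 0 < 1 / β := by positivity
  have h4 : 0 < 6 / (β - 1) := div_pos (by norm_num) (by linarith)
  set f := β + 4 + 1 / β + 6 / (β - 1) with hf
  -- Increasing `β` by `δ` increases the bracket by at most the factor `1 + δ ≤ exp δ`.
  have h5 : β' + 4 + 1 / β' + 6 / (β' - 1) ≤ Real.exp (β' - β) * f := by
    have := Real.add_one_le_exp (β' - β)
    nlinarith
  have h6 : Real.exp (-β) = Real.exp (-β') * Real.exp (β' - β) := by
    rw [← Real.exp_add]; congr 1; ring
  rw [h6, mul_assoc]
  gcongr

lemma one_sub_mul_exp_le {u : ℝ} (hu0 : 0 ≤ u) :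
    (1 - u) * Real.exp u ≤ 1 - u ^ 2 / 2 := by
  -- The difference `u ^ 2 / 2 + (1 - u) * exp u` has derivative `u - u * exp u ≤ 0`.
  have hd : ∀ t : ℝ, HasDerivAt (fun t => t ^ 2 / 2 + (1 - t) * Real.exp t)
      (t - t * Real.exp t) t := fun t => by
    have h1 := ((hasDerivAt_id t).pow 2).div_const 2
    have h2 := ((hasDerivAt_id t).const_sub 1).mul (Real.hasDerivAt_exp t)
    refine (h1.add h2).congr_deriv ?_
    simp only [id]
    ring
  have hanti : AntitoneOn (fun t : ℝ => t ^ 2 / 2 + (1 - t) * Real.exp t) (Set.Ici 0) := by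
    refine antitoneOn_of_deriv_nonpos (convex_Ici 0)
      (fun t _ => (hd t).continuousAt.continuousWithinAt)
      (fun t _ => (hd t).differentiableAt.differentiableWithinAt) fun t ht => ?_
    rw [interior_Ici] at ht
    rw [(hd t).deriv]
    have ht0 : (0 : ℝ) < t := ht
    nlinarith [Real.one_le_exp ht0.le]
  have := hanti Set.self_mem_Ici (Set.mem_Ici.2 hu0) hu0
  norm_num at this
  linarith

/-- What remains of `excess_le` in the main case, with `s = β - 1`, `v = 1 - u`, and `v * exp u`
replaced by its upper bound `1 - u ^ 2 / 2`. -/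
lemma rational_bound {s v : ℝ} (hs : 0 < s) (hv0 : 0 ≤ v) (hv1 : v ≤ 1) :
    (1 - (1 - v) ^ 2 / 2) * (2 + 3 / s + 6 * (1 + s) / (s + v)) ≤
      6 * (1 + s) / s + s ^ 2 / (1 + s) := by
  have hsv : 0 < s + v := by linarith
  have hs1 : 0 < 1 + s := by linarith
  rw [← sub_nonneg]
  have key : 6 * (1 + s) / s + s ^ 2 / (1 + s)
      - (1 - (1 - v) ^ 2 / 2) * (2 + 3 / s + 6 * (1 + s) / (s + v))
      = (2 * s ^ 4 + (4 - 14 * v + 8 * v ^ 2) * s ^ 3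
        + (7 - 24 * v + 13 * v ^ 2 + 2 * v ^ 3) * s ^ 2
        + (3 + v - v ^ 2 + 5 * v ^ 3) * s + (9 * v - 6 * v ^ 2 + 3 * v ^ 3))
        / (2 * s * (1 + s) * (s + v)) := by
    field_simp
    ring
  rw [key]
  refine div_nonneg ?_ (by positivity)
  have hC : 3 ≤ 3 + v - v ^ 2 + 5 * v ^ 3 := by
    have : 0 ≤ v * (1 - v) := mul_nonneg hv0 (by linarith)
    have : 0 ≤ v ^ 3 := by positivity
    nlinarith
  -- For small `v` all coefficients are nonnegative; otherwise the constant term is large enough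
  -- to bound the coefficients by constants.
  rcases le_total v (1 / 5) with hv | hv
  · have hA : 0 ≤ 4 - 14 * v + 8 * v ^ 2 := by nlinarith
    have hB : 0 ≤ 7 - 24 * v + 13 * v ^ 2 + 2 * v ^ 3 := by
      have : 0 ≤ v ^ 3 := by positivity
      nlinarith
    have hE : 0 ≤ 9 * v - 6 * v ^ 2 + 3 * v ^ 3 := by
      have : 0 ≤ v ^ 3 := by positivity
      nlinarith
    have := hC.trans' (by norm_num : (0 : ℝ) ≤ 3)
    positivity
  · have hA : -(17 / 8) ≤ 4 - 14 * v + 8 * v ^ 2 := by nlinarith [sq_nonneg (v - 7 / 8)]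
    have hB : -3 ≤ 7 - 24 * v + 13 * v ^ 2 + 2 * v ^ 3 := by
      nlinarith [mul_nonneg hv0 (sq_nonneg (v - 4 / 5)), sq_nonneg (v - 4 / 5)]
    have hE : 3 / 2 ≤ 9 * v - 6 * v ^ 2 + 3 * v ^ 3 := by
      nlinarith [mul_nonneg (sub_nonneg.2 hv) (sub_nonneg.2 hv1),
        mul_nonneg hv0 (sq_nonneg (v - 1 / 2))]
    have hq : 0 ≤ 2 * s ^ 4 + -(17 / 8) * s ^ 3 + -3 * s ^ 2 + 3 * s + 3 / 2 := by
      nlinarith [sq_nonneg (s ^ 2 - 17 / 32 * s - 1), sq_nonneg (s - 1), sq_nonneg (s ^ 2 - 1),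
        sq_nonneg (s ^ 2 - s)]
    refine hq.trans ?_
    gcongr

/-- The bound on the excess cost of a point over its LP radius `R`. Here `r` and `r'` are the
radii of the balls of the point and of its witness, `a` is the average distance in the ball of the
witness, `m` the contribution to `a` of the copies that do not serve the point, `u` the probability
that the ball of the witness hits a serving copy and `Po` the probability that no other group does.
The two constraints `hr`, `hr'` compare these quantities with `R`; since `Po` can exceed `exp (-β)`
by the factor `exp u`, `u` has to be traded against the miss probability `1 - u` of the witness
ball. -/
lemma excess_le {β R r r' a m u Po : ℝ} (hβ : 1 < β) (hR : 0 ≤ R)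
    (hr : (β - 1) * r ≤ β * R) (hr' : a + (β - 1) * r' ≤ β * R)
    (hm : m ≤ a) (hm0 : 0 ≤ m) (hmu : m ≤ (1 - u) * r') (hu0 : 0 ≤ u) (hu1 : u ≤ 1)
    (hPo0 : 0 ≤ Po) (hPo : Po ≤ Real.exp (-(β - u))) :
    Po * ((1 - u) * (3 * (r + r') - R) + 3 * m) ≤
      Real.exp (-β) * (6 * β / (β - 1) + (β - 1) ^ 2 / β) * R := by
  set s := β - 1 with hs
  set v := 1 - u with hv
  have hs0 : 0 < s := by simp only [hs]; linarith
  have hv0 : 0 ≤ v := by simp only [hv]; linarith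
  have hv1 : v ≤ 1 := by simp only [hv]; linarith
  have hβs : β = 1 + s := by simp only [hs]; ring
  have huv : u = 1 - v := by simp only [hv]; ring
  have hsv : 0 < s + v := by linarith
  have hT : 6 * β / s + s ^ 2 / β = 6 * (1 + s) / s + s ^ 2 / (1 + s) := by rw [hβs]
  have hr1 : 3 * (v * r) ≤ v * (3 * (1 + s) / s) * R := by
    have : r ≤ (1 + s) / s * R := by
      rw [div_mul_eq_mul_div, le_div_iff₀ hs0, ← hβs]; linarith
    calc 3 * (v * r) ≤ 3 * (v * ((1 + s) / s * R)) := by gcongr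
      _ = _ := by ring
  have hexp : v * Real.exp u ≤ 1 - (1 - v) ^ 2 / 2 := by
    rw [huv, show v = 1 - (1 - v) by ring]
    simpa using one_sub_mul_exp_le (u := 1 - v) (by linarith)
  -- It suffices to bound the bracket by `v * K * R` with `v * exp u * K` at most the target.
  suffices h : ∃ K, 0 ≤ K ∧ v * (3 * (r + r') - R) + 3 * m ≤ v * K * R ∧
      (1 - (1 - v) ^ 2 / 2) * K ≤ 6 * (1 + s) / s + s ^ 2 / (1 + s) by
    obtain ⟨K, hK0, hK1, hK2⟩ := h
    have hvKR : 0 ≤ v * K * R := by positivity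
    calc Po * (v * (3 * (r + r') - R) + 3 * m) ≤ Po * (v * K * R) := by gcongr
      _ ≤ Real.exp (-(β - u)) * (v * K * R) := by gcongr
      _ = Real.exp (-β) * ((v * Real.exp u) * K) * R := by
          rw [show -(β - u) = -β + u by ring, Real.exp_add]; ring
      _ ≤ Real.exp (-β) * ((1 - (1 - v) ^ 2 / 2) * K) * R := by gcongr
      _ ≤ _ := by rw [hT]; gcongr
  rcases le_total v s with hvs | hvs
  · -- The convex combination of `m ≤ a` and `m ≤ v * r'` with weight `t` on the first one
    -- makes `v * r' + m` a multiple of `a + s * r'`.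
    set t := 2 * v / (s + v) with ht
    have ht0 : 0 ≤ t := by positivity
    have ht1 : 0 ≤ 1 - t := by
      rw [sub_nonneg, ht, div_le_one hsv]; linarith
    have h1 : v * r' + m ≤ v * r' + (t * a + (1 - t) * (v * r')) := by nlinarith
    have h2 : v * r' + (t * a + (1 - t) * (v * r')) = t * (a + s * r') := by
      rw [ht]; field_simp; ring
    have h3 : t * (a + s * r') ≤ t * (β * R) := mul_le_mul_of_nonneg_left hr' ht0
    have h4 : 3 * (t * (β * R)) = v * (6 * (1 + s) / (s + v)) * R := by
      rw [ht, hβs]; field_simp; ring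
    refine ⟨2 + 3 / s + 6 * (1 + s) / (s + v), by positivity, ?_, rational_bound hs0 hv0 hv1⟩
    have h5 : v * (3 * (1 + s) / s) * R = v * (3 + 3 / s) * R := by field_simp; ring
    linarith
  · -- Here `a` costs at least as much as `r'` in the constraint `a + s * r' ≤ β * R`.
    have h1 : v * r' + m ≤ v / s * (β * R) := by
      calc v * r' + m ≤ v / s * (s * r') + v / s * a := by
            have e : v / s * (s * r') = v * r' := by field_simp
            have : a ≤ v / s * a :=
              le_mul_of_one_le_left (hm0.trans hm) ((one_le_div hs0).2 hvs)
            linarith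
        _ = v / s * (a + s * r') := by ring
        _ ≤ _ := by gcongr
    have h2 : 3 * (v / s * (β * R)) = v * (3 * (1 + s) / s) * R := by
      rw [hβs]; ring
    have hK : 6 * (1 + s) / s - 1 = 5 + 6 / s := by field_simp; ring
    refine ⟨6 * (1 + s) / s - 1, by rw [hK]; positivity, ?_, ?_⟩
    · have : v * (6 * (1 + s) / s - 1) * R
          = v * (3 * (1 + s) / s) * R + v * (3 * (1 + s) / s) * R - v * R := by ring
      linarith
    · have h3 : 0 ≤ 6 * (1 + s) / s - 1 := by rw [hK]; positivity
      have h4 : 0 ≤ s ^ 2 / (1 + s) := by positivity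
      nlinarith [mul_nonneg (sq_nonneg (1 - v)) h3]

/-- If `p` decreases while `a` increases, then the mean of `a` with weights `q * p` is at most its
mean with weights `q`. -/
lemma sum_mul_mul_sum_le {n : ℕ} {q p a : Fin n → ℝ} (hq : ∀ i, 0 ≤ q i) (hp : Antitone p)
    (ha : Monotone a) :
    (∑ i, q i * p i * a i) * ∑ i, q i ≤ (∑ i, q i * p i) * ∑ i, q i * a i := by
  have h : 0 ≤ ∑ i, ∑ j, q i * q j * ((p i - p j) * (a j - a i)) := by
    refine Finset.sum_nonneg fun i _ => Finset.sum_nonneg fun j _ =>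
      mul_nonneg (mul_nonneg (hq i) (hq j)) ?_
    rcases le_total i j with hij | hij
    · exact mul_nonneg (sub_nonneg.2 (hp hij)) (sub_nonneg.2 (ha hij))
    · exact mul_nonneg_of_nonpos_of_nonpos (sub_nonpos.2 (hp hij)) (sub_nonpos.2 (ha hij))
  have e : ∀ i j, q i * q j * ((p i - p j) * (a j - a i)) =
      (q i * p i) * (q j * a j) + (q i * a i) * (q j * p j)
        - (q i * p i * a i) * q j - q i * (q j * p j * a j) := fun i j => by ring
  simp only [e, Finset.sum_add_distrib, Finset.sum_sub_distrib, ← Finset.mul_sum,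
    ← Finset.sum_mul] at h
  linarith

namespace RelaxedKMedian

variable {X C : Type*}

/-! ### The linear program -/

lemma distTo_le (I : RelaxedKMedian X C) (x : X) {S : Finset C} {c : C} (hc : c ∈ S) :
    I.distTo x S ≤ I.d x c :=
  ciInf_le (Set.finite_range fun c : S => I.d x c).bddBelow (⟨c, hc⟩ : S)

lemma exists_distTo_eq (I : RelaxedKMedian X C) (x : X) {S : Finset C} (hS : S.Nonempty) :
    ∃ c ∈ S, I.d x c = I.distTo x S := by
  have : Nonempty S := hS.to_subtype
  obtain ⟨c, hc⟩ := exists_eq_ciInf_of_finite (f := fun c : S => I.d x c)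
  exact ⟨c, c.2, hc⟩

variable [Fintype C]

lemma lpRadius_nonneg {I : RelaxedKMedian X C} {y : C → ℝ} {z : X → C → ℝ}
    (h : I.LPFeasible y z) (x : X) : 0 ≤ I.lpRadius z x :=
  Finset.sum_nonneg fun c _ => mul_nonneg (h.z_nonneg x c) (I.d_nonneg x c)

variable [Fintype X]

lemma lpObjective_eq_sum_lpRadius (I : RelaxedKMedian X C) (z : X → C → ℝ) :
    I.lpObjective z = ∑ x, I.lpRadius z x := Finset.sum_comm

lemma isCompact_setOf_LPFeasible (I : RelaxedKMedian X C) :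
    IsCompact {p : (C → ℝ) × (X → C → ℝ) | I.LPFeasible p.1 p.2} := by
  have hset : {p : (C → ℝ) × (X → C → ℝ) | I.LPFeasible p.1 p.2} =
      {p | ∑ c, p.1 c = (I.k : ℝ)} ∩ {p | ∀ x, ∑ c, p.2 x c = 1} ∩ {p | ∀ x c, p.2 x c ≤ p.1 c} ∩
        {p | ∀ c, 0 ≤ p.1 c} ∩ {p | ∀ x c, 0 ≤ p.2 x c} := by
    ext p
    exact ⟨fun h => ⟨⟨⟨⟨h.1, h.2⟩, h.3⟩, h.4⟩, h.5⟩,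
      fun ⟨⟨⟨⟨h1, h2⟩, h3⟩, h4⟩, h5⟩ => ⟨h1, h2, h3, h4, h5⟩⟩
  refine Metric.isCompact_of_isClosed_isBounded ?_ ?_
  · rw [hset]
    simp only [Set.ofPred_forall]
    refine ((((isClosed_eq (by fun_prop) (by fun_prop)).inter
      (isClosed_iInter fun x => isClosed_eq (by fun_prop) (by fun_prop))).inter
      (isClosed_iInter fun x => isClosed_iInter fun c => isClosed_le (by fun_prop) (by fun_prop))).inter
      (isClosed_iInter fun c => isClosed_le (by fun_prop) (by fun_prop))).inter
      (isClosed_iInter fun x => isClosed_iInter fun c => isClosed_le (by fun_prop) (by fun_prop))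
  · refine (Metric.isBounded_Icc (0 : (C → ℝ) × (X → C → ℝ))
      (fun _ => (I.k : ℝ), fun _ _ => (I.k : ℝ))).subset fun p hp => ?_
    have hy : ∀ c, p.1 c ≤ I.k := fun c => by
      rw [← hp.sum_y]
      exact Finset.single_le_sum (fun c _ => hp.y_nonneg c) (Finset.mem_univ c)
    exact ⟨⟨hp.y_nonneg, hp.z_nonneg⟩, ⟨hy, fun x c => (hp.z_le_y x c).trans (hy c)⟩⟩

lemma exists_LPFeasible_lpObjective_eq_cost [DecidableEq C] (I : RelaxedKMedian X C) {S : Finset C}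
    (hS : S.Nonempty) (hcard : S.card ≤ I.k) :
    ∃ y z, I.LPFeasible y z ∧ I.lpObjective z = I.cost S := by
  choose near hmem hnear using fun x => I.exists_distTo_eq x hS
  obtain ⟨c₀, -⟩ := hS
  -- The integral solution opens each center of `S` once; the budget left over goes to `c₀`.
  have hcard' : (S.card : ℝ) ≤ I.k := by exact_mod_cast hcard
  refine ⟨fun c => (if c ∈ S then 1 else 0) + if c = c₀ then (I.k : ℝ) - S.card else 0,
    fun x c => if c = near x then 1 else 0, ⟨?_, ?_, ?_, ?_, ?_⟩, ?_⟩
  · simp [Finset.sum_add_distrib]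
  · simp
  · intro x c
    have : (0 : ℝ) ≤ if c = c₀ then (I.k : ℝ) - S.card else 0 := by
      split_ifs <;> linarith
    by_cases h : c = near x
    · subst h
      simpa [hmem x] using this
    · simp only [h, if_false]
      positivity
  · intro c
    have : (0 : ℝ) ≤ if c = c₀ then (I.k : ℝ) - S.card else 0 := by
      split_ifs <;> linarith
    positivity
  · intro x c
    positivity
  · rw [lpObjective_eq_sum_lpRadius]
    simp [lpRadius, cost, hnear]

lemma exists_LPOptimal [Nonempty C] (I : RelaxedKMedian X C) : ∃ y z, I.LPOptimal y z := by
  classical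
  obtain ⟨c⟩ := ‹Nonempty C›
  obtain ⟨y₀, z₀, h₀, -⟩ := I.exists_LPFeasible_lpObjective_eq_cost (S := {c}) (by simp)
    (by simpa using Nat.one_le_iff_ne_zero.2 I.k_pos.ne')
  have hcont : Continuous fun p : (C → ℝ) × (X → C → ℝ) => I.lpObjective p.2 := by
    unfold lpObjective
    fun_prop
  obtain ⟨p, hp, hmin⟩ := I.isCompact_setOf_LPFeasible.exists_isMinOn ⟨(y₀, z₀), h₀⟩
    hcont.continuousOn
  exact ⟨p.1, p.2, hp, fun y' z' h' => hmin (a := (y', z')) h'⟩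

lemma LPOptimal.lpObjective_le_cost [DecidableEq C] {I : RelaxedKMedian X C} {y : C → ℝ}
    {z : X → C → ℝ} (h : I.LPOptimal y z) {S : Finset C} (hS : S.Nonempty) (hcard : S.card ≤ I.k) :
    I.lpObjective z ≤ I.cost S := by
  obtain ⟨y', z', hf, he⟩ := I.exists_LPFeasible_lpObjective_eq_cost hS hcard
  exact he ▸ h.2 y' z' hf

end RelaxedKMedian

/-! ### Splitting weights -/

/-- The elements of positive weight of a finite type can be enumerated without changing any
weighted sum. -/
lemma exists_enum_support {A : Type*} [Fintype A] (w : A → ℝ) (hw : ∀ a, 0 ≤ w a) :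
    ∃ (n : ℕ) (l : Fin n → A), (∀ q, 0 < w (l q)) ∧
      ∀ (P : A → Prop) [DecidablePred P], ∑ q with P (l q), w (l q) = ∑ a with P a, w a := by
  classical
  let e := Fintype.equivFin {a // 0 < w a}
  refine ⟨_, fun q => (e.symm q).1, fun q => (e.symm q).2, fun P _ => ?_⟩
  rw [Finset.sum_filter, Finset.sum_filter,
    Equiv.sum_comp e.symm fun a : {a // 0 < w a} => if P a.1 then w a.1 else 0,
    ← Finset.sum_subtype (Finset.univ.filter fun a => 0 < w a) (by simp)
      fun a => if P a then w a else 0, Finset.sum_filter]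
  refine Finset.sum_congr rfl fun a _ => ?_
  split_ifs with h1 h2 h2
  · rfl
  · rfl
  · exact le_antisymm (hw a) (not_lt.1 h1)
  · rfl

/-- Weights `y` can be split into finitely many positive copies so that every demand `τ j` is
served by a set of copies. The copies of `c` are indexed by the maps `J → Bool`, and they share
`y c` as if each demand cut `c` independently of the others. -/
lemma exists_split {C J : Type*} [Fintype C] [DecidableEq C] [Fintype J] (y : C → ℝ)
    (τ : J → C → ℝ) (hτ0 : ∀ j c, 0 ≤ τ j c) (hτy : ∀ j c, τ j c ≤ y c) (hy : ∀ c, 0 ≤ y c) :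
    ∃ (n : ℕ) (loc : Fin n → C) (wt : Fin n → ℝ) (S : J → Finset (Fin n)),
      (∀ p, 0 < wt p) ∧ (∀ c, ∑ p with loc p = c, wt p = y c) ∧
      ∀ j c, ∑ p ∈ S j with loc p = c, wt p = τ j c := by
  classical
  let F : C → J → Bool → ℝ := fun c j b => if b then τ j c / y c else 1 - τ j c / y c
  have hF0 : ∀ c j b, 0 ≤ F c j b := by
    intro c j b
    have h1 : τ j c / y c ≤ 1 := div_le_one_of_le₀ (hτy j c) (hy c)
    have h2 : 0 ≤ τ j c / y c := div_nonneg (hτ0 j c) (hy c)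
    dsimp only [F]
    split_ifs <;> linarith
  have hsum : ∀ c j, ∑ b, F c j b = 1 := fun c j => by simp [F]
  let w : C × (J → Bool) → ℝ := fun a => y a.1 * ∏ j, F a.1 j (a.2 j)
  have hw0 : ∀ a, 0 ≤ w a := fun a =>
    mul_nonneg (hy _) (Finset.prod_nonneg fun j _ => hF0 _ _ _)
  obtain ⟨n, l, hpos, hl⟩ := exists_enum_support w hw0
  have hfib : ∀ (c : C) (P : (J → Bool) → Prop) [DecidablePred P],
      ∑ a : C × (J → Bool) with P a.2 ∧ a.1 = c, w a =
        y c * ∑ f : J → Bool, if P f then ∏ j, F c j (f j) else 0 := by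
    intro c P _
    rw [Finset.sum_filter, Fintype.sum_prod_type, Finset.sum_eq_single c]
    · simp only [and_true, w, Finset.mul_sum, mul_ite, mul_zero]
    · intro b _ hb
      simp [hb]
    · simp
  refine ⟨n, fun q => (l q).1, fun q => w (l q), fun j => {q | (l q).2 j = true}, hpos, ?_, ?_⟩
  · intro c
    have h1 := hl (fun a => True ∧ a.1 = c)
    rw [hfib c fun _ => True] at h1
    simp only [true_and, if_true] at h1
    have h2 := Finset.prod_univ_sum (fun _ : J => (Finset.univ : Finset Bool)) (F c)
    simp only [hsum, Finset.prod_const_one, Fintype.piFinset_univ] at h2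
    rw [h1, ← h2, mul_one]
  · intro j c
    rw [Finset.filter_filter]
    have h1 := hl (fun a => a.2 j = true ∧ a.1 = c)
    rw [hfib c fun f => f j = true] at h1
    -- The terms with `f j = false` are removed by a factor at `j`.
    have h2 := Finset.prod_univ_sum (fun _ : J => (Finset.univ : Finset Bool))
      (fun i b => if i = j ∧ b = false then 0 else F c i b)
    have h3 : ∏ i, ∑ b, (if i = j ∧ b = false then 0 else F c i b) = τ j c / y c := by
      rw [Finset.prod_eq_single j]
      · simp [F]
      · intro i _ hi
        simpa [hi] using hsum c i
      · simp
    have h4 : ∀ f : J → Bool, (∏ i, if i = j ∧ f i = false then 0 else F c i (f i)) =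
        if f j = true then ∏ i, F c i (f i) else 0 := by
      intro f
      split_ifs with hf
      · refine Finset.prod_congr rfl fun i _ => if_neg ?_
        rintro ⟨rfl, h⟩
        simp [hf] at h
      · exact Finset.prod_eq_zero (Finset.mem_univ j) (if_pos ⟨rfl, by simpa using hf⟩)
    rw [h3, Fintype.piFinset_univ] at h2
    simp only [h4] at h2
    rw [h1, ← h2]
    rcases (hy c).eq_or_lt with h | h
    · have := hτy j c
      rw [← h] at this ⊢
      rw [zero_mul, le_antisymm this (hτ0 j c)]
    · field_simp

/-- A fractional ball: the prescribed weight `t` can be filled up from capacities `y` in order of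
increasing distance `d`. -/
lemma exists_fractional_ball {C : Type*} [DecidableEq C] (d y : C → ℝ) (hy : ∀ c, 0 ≤ y c)
    (s : Finset C) : ∀ t, 0 ≤ t → t ≤ ∑ c ∈ s, y c →
    ∃ b : C → ℝ, (∀ c, 0 ≤ b c) ∧ (∀ c, b c ≤ y c) ∧ ∑ c ∈ s, b c = t ∧
      ∀ c ∈ s, ∀ c' ∈ s, 0 < b c → b c' < y c' → d c ≤ d c' := by
  induction s using Finset.induction_on_max_value d with
  | empty =>
    intro t h0 h1
    exact ⟨0, by simp, hy, by simpa using le_antisymm h0 (by simpa using h1), by simp⟩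
  | insert a s ha hmax ih =>
    intro t h0 h1
    rw [Finset.sum_insert ha] at h1
    rcases le_total t (∑ c ∈ s, y c) with h | h
    · obtain ⟨b, hb0, hby, hbt, hbd⟩ := ih t h0 h
      have hne : ∀ c ∈ s, c ≠ a := fun c hc e => ha (e ▸ hc)
      refine ⟨Function.update b a 0, fun c => ?_, fun c => ?_, ?_, ?_⟩
      · rcases eq_or_ne c a with rfl | hc <;> simp [*]
      · rcases eq_or_ne c a with rfl | hc <;> simp [*]
      · rw [Finset.sum_insert ha, Function.update_self, zero_add, ← hbt]
        exact Finset.sum_congr rfl fun c hc => by simp [hne c hc]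
      · intro c hc c' hc' h2 h3
        rcases eq_or_ne c a with rfl | hca
        · simp at h2
        have hcs := Finset.mem_of_mem_insert_of_ne hc hca
        rcases eq_or_ne c' a with rfl | hca'
        · exact hmax c hcs
        have hcs' := Finset.mem_of_mem_insert_of_ne hc' hca'
        rw [Function.update_of_ne hca] at h2
        rw [Function.update_of_ne hca'] at h3
        exact hbd c hcs c' hcs' h2 h3
    · refine ⟨Function.update y a (t - ∑ c ∈ s, y c), fun c => ?_, fun c => ?_, ?_, ?_⟩
      · rcases eq_or_ne c a with rfl | hc <;> simp [*]
      · rcases eq_or_ne c a with rfl | hc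
        · simp; linarith
        · simp [*]
      · have hs : ∑ c ∈ s, Function.update y a (t - ∑ c ∈ s, y c) c = ∑ c ∈ s, y c :=
          Finset.sum_congr rfl fun c hc => by simp [show c ≠ a from fun e => ha (e ▸ hc)]
        rw [Finset.sum_insert ha, Function.update_self, hs]
        ring
      · intro c hc c' hc' _ h3
        rcases eq_or_ne c' a with rfl | hca'
        · rcases Finset.mem_insert.1 hc with rfl | hc
          · exact le_rfl
          · exact hmax c hc
        · simp [hca'] at h3

/-- A greedy choice along a ranking: an element is chosen if and only if it is compatible, in the
sense of `Q`, with the elements of smaller rank that have been chosen. -/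
lemma exists_greedy_set {X : Type*} (rank : X → ℕ) (Q : X → X → Prop) :
    ∃ S : Set X, ∀ x, x ∈ S ↔ ∀ x' ∈ S, rank x' < rank x → Q x x' := by
  let wf := (measure rank).wf
  let S : X → Prop := wf.fix fun x rec => ∀ x' (h : rank x' < rank x), rec x' h → Q x x'
  refine ⟨{x | S x}, fun x => ?_⟩
  have h : S x = ∀ x' (_ : rank x' < rank x), S x' → Q x x' := wf.fix_eq _ x
  change S x ↔ ∀ x', S x' → rank x' < rank x → Q x x'
  rw [h]
  exact ⟨fun h x' h1 h2 => h x' h2 h1, fun h x' h1 h2 => h x' h2 h1⟩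

/-! ### Executions of the algorithm exist -/

/-- Disjoint sets of weight `δ` inside a total weight `N * δ` can be completed to a partition into
sets of weight `δ` after splitting the weights further: what lies outside the sets is shared
equally by the missing groups. -/
lemma exists_split_groups {n N : ℕ} {wt : Fin n → ℝ} (hwt : ∀ p, 0 < wt p) {δ : ℝ} (hδ : 0 < δ)
    (hN : ∑ p, wt p = N * δ) {K : Type*} [Fintype K] {B : K → Finset (Fin n)}
    (hB : ∀ x, ∑ p ∈ B x, wt p = δ) (hdisj : Pairwise fun x x' => Disjoint (B x) (B x')) :
    ∃ (n' : ℕ) (π : Fin n' → Fin n) (wt' : Fin n' → ℝ)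
      (G : Finpartition (Finset.univ : Finset (Fin n'))),
      (∀ q, 0 < wt' q) ∧
      (∀ (P : Fin n → Prop) [DecidablePred P], ∑ q with P (π q), wt' q = ∑ p with P p, wt p) ∧
      (∀ g ∈ G.parts, ∑ q ∈ g, wt' q = δ) ∧ ∀ x, Finset.univ.filter (π · ∈ B x) ∈ G.parts := by
  classical
  set D : Finset (Fin n) := Finset.univ.biUnion B with hD
  have hDw : ∑ p ∈ D, wt p = Fintype.card K * δ := by
    rw [hD, Finset.sum_biUnion fun x _ x' _ h => hdisj h]
    simp [hB]
  have hDc : ∑ p ∈ Dᶜ, wt p = N * δ - Fintype.card K * δ := by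
    rw [← hN, ← hDw, ← Finset.sum_add_sum_compl D]; ring
  have hcard : Fintype.card K ≤ N := by
    have : 0 ≤ ∑ p ∈ Dᶜ, wt p := Finset.sum_nonneg fun p _ => (hwt p).le
    have : (Fintype.card K : ℝ) ≤ N := by
      rw [hDc, ← sub_mul] at this
      linarith [nonneg_of_mul_nonneg_left this hδ]
    exact_mod_cast this
  set M := N - Fintype.card K with hM
  have hDcM : ∑ p ∈ Dᶜ, wt p = M * δ := by
    rw [hDc, hM, Nat.cast_sub hcard]; ring
  -- The share of `p` that goes to each group.
  let κ : Fin n → K ⊕ Fin M → ℝ := fun p => Sum.elim (fun x => if p ∈ B x then 1 else 0)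
    fun _ => if p ∈ D then 0 else 1 / M
  have hκ0 : ∀ p j, 0 ≤ κ p j := by
    rintro p (x | j) <;> simp only [κ, Sum.elim_inl, Sum.elim_inr] <;> positivity
  have hκ1 : ∀ p, ∑ j, κ p j = 1 := by
    intro p
    rw [Fintype.sum_sum_type]
    simp only [κ, Sum.elim_inl, Sum.elim_inr, Finset.sum_const, Finset.card_univ, Fintype.card_fin,
      nsmul_eq_mul]
    by_cases hp : p ∈ D
    · obtain ⟨x, -, hx⟩ := Finset.mem_biUnion.1 hp
      rw [Finset.sum_eq_single x]
      · simp [hx, hp]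
      · intro x' _ hx'
        exact if_neg fun h => Finset.disjoint_left.1 (hdisj hx') h hx
      · simp
    · have hM0 : (M : ℝ) ≠ 0 := by
        intro h
        have h1 := Finset.single_le_sum (f := wt) (fun p _ => (hwt p).le)
          (Finset.mem_compl.2 hp)
        rw [hDcM, h, zero_mul] at h1
        exact (hwt p).not_ge h1
      rw [Finset.sum_eq_zero]
      · simp [hp, hM0]
      · intro x _
        exact if_neg fun h => hp (Finset.mem_biUnion.2 ⟨x, Finset.mem_univ x, h⟩)
  have hκw : ∀ j, ∑ p, wt p * κ p j = δ := by
    rintro (x | j)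
    · simp [κ, hB]
    · have hM0 : (M : ℝ) ≠ 0 := by exact_mod_cast (Fin.pos j).ne'
      have : ∑ p, wt p * κ p (Sum.inr j) = (∑ p ∈ Dᶜ, wt p) * (1 / M) := by
        rw [Finset.sum_mul, ← Finset.sum_add_sum_compl D,
          Finset.sum_eq_zero fun p hp => by simp [κ, hp], zero_add]
        exact Finset.sum_congr rfl fun p hp => by simp [κ, Finset.mem_compl.1 hp]
      rw [this, hDcM]
      field_simp
  obtain ⟨n', l, hpos, hl⟩ := exists_enum_support (fun a : Fin n × (K ⊕ Fin M) => wt a.1 * κ a.1 a.2)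
    fun a => mul_nonneg (hwt _).le (hκ0 _ _)
  have hκpos : ∀ q, 0 < κ (l q).1 (l q).2 := fun q =>
    pos_of_mul_pos_right (hpos q) (hwt _).le
  have hgw : ∀ j, ∑ q with (l q).2 = j, wt (l q).1 * κ (l q).1 (l q).2 = δ := by
    intro j
    rw [hl fun a => a.2 = j, Finset.sum_filter, Fintype.sum_prod_type, ← hκw j]
    exact Finset.sum_congr rfl fun p _ => by simp
  have hne : ∀ j, (Finset.univ.filter fun q => (l q).2 = j).Nonempty := by
    intro j
    rw [Finset.nonempty_iff_ne_empty]
    intro h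
    have := hgw j
    rw [h, Finset.sum_empty] at this
    exact hδ.ne this
  refine ⟨n', fun q => (l q).1, _, Finpartition.ofExistsUnique
    (Finset.univ.image fun j => Finset.univ.filter fun q => (l q).2 = j)
    (fun _ _ => Finset.subset_univ _) ?_ ?_, hpos, ?_, ?_, ?_⟩
  · intro q _
    refine ⟨Finset.univ.filter fun q' => (l q').2 = (l q).2, by simp, ?_⟩
    rintro g ⟨hg, hqg⟩
    obtain ⟨j, -, rfl⟩ := Finset.mem_image.1 hg
    rw [(Finset.mem_filter.1 hqg).2]
  · intro h
    obtain ⟨j, -, hj⟩ := Finset.mem_image.1 h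
    exact (hne j).ne_empty hj
  · intro P _
    rw [hl fun a => P a.1, Finset.sum_filter, Finset.sum_filter, Fintype.sum_prod_type]
    refine Finset.sum_congr rfl fun p _ => ?_
    by_cases hp : P p
    · simp [hp, ← Finset.mul_sum, hκ1]
    · simp [hp]
  · intro g hg
    obtain ⟨j, -, rfl⟩ := Finset.mem_image.1 hg
    exact hgw j
  · intro x
    refine Finset.mem_image.2 ⟨Sum.inl x, Finset.mem_univ _, ?_⟩
    ext q
    have hq := hκpos q
    simp only [Finset.mem_filter, Finset.mem_univ, true_and]
    constructor
    · intro h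
      rw [h] at hq
      by_contra hx
      simp [κ, hx] at hq
    · intro h
      rcases hj : (l q).2 with x' | j
      · rw [hj] at hq
        have hx' : (l q).1 ∈ B x' := by
          by_contra hx
          simp [κ, hx] at hq
        by_contra hne
        exact Finset.disjoint_left.1 (hdisj fun e : x' = x => hne (by rw [e])) hx' h
      · rw [hj] at hq
        have : (l q).1 ∈ D := Finset.mem_biUnion.2 ⟨x, Finset.mem_univ x, h⟩
        simp [κ, this] at hq

namespace RelaxedKMedian

variable {X C : Type*} [Fintype X] [Fintype C] [DecidableEq C]

/-- From every feasible LP solution the algorithm can be executed. -/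
theorem nonempty_execution {I : RelaxedKMedian X C} {β : ℝ} (hβ : 1 < β) {N : ℕ}
    (hN : β * I.k = N) {y : C → ℝ} {z : X → C → ℝ} (h : I.LPFeasible y z) :
    Nonempty (I.Execution β y z) := by
  classical
  have hβ0 : 0 < β := by linarith
  have hk : (1 : ℝ) ≤ I.k := by exact_mod_cast I.k_pos
  have hball : 1 / β ≤ ∑ c, y c := by
    rw [h.sum_y]
    exact ((div_le_one hβ0).2 hβ.le).trans hk
  choose b hb0 hby hbsum hbd using fun x =>
    exists_fractional_ball (I.d x) y h.y_nonneg Finset.univ (1 / β) (by positivity) hball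
  obtain ⟨n, loc, wt, S, hwt, hloc, hS⟩ := exists_split y (Sum.elim z b)
    (by rintro (x | x) c; exacts [h.z_nonneg x c, hb0 x c])
    (by rintro (x | x) c; exacts [h.z_le_y x c, hby x c]) h.y_nonneg
  let B : X → Finset (Fin n) := fun x => S (Sum.inr x)
  have hBw : ∀ x, ∑ p ∈ B x, wt p = 1 / β := by
    intro x
    rw [← Finset.sum_fiberwise (B x) loc, ← hbsum x]
    exact Finset.sum_congr rfl fun c _ => hS (Sum.inr x) c
  have hBd : ∀ x, ∀ p ∈ B x, ∀ q ∉ B x, I.d x (loc p) ≤ I.d x (loc q) := by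
    intro x p hp q hq
    refine hbd x _ (Finset.mem_univ _) _ (Finset.mem_univ _) ?_ ?_
    · have h1 : ∑ p' ∈ B x with loc p' = loc p, wt p' = b x (loc p) := hS (Sum.inr x) (loc p)
      rw [← h1]
      exact Finset.sum_pos (fun p _ => hwt p) ⟨p, by simp [hp]⟩
    · have h1 : ∑ p' ∈ B x with loc p' = loc q, wt p' = b x (loc q) := hS (Sum.inr x) (loc q)
      rw [← h1, ← hloc (loc q)]
      refine Finset.sum_lt_sum_of_subset
        (Finset.filter_subset_filter _ (Finset.subset_univ _)) (i := q) (by simp) (by simp [hq])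
        (hwt q) fun p _ _ => (hwt p).le
  let e := Fintype.equivFin X
  let σ := Tuple.sort (I.lpRadius z ∘ e.symm)
  let order : Fin (Fintype.card X) ≃ X := σ.trans e.symm
  have horder : Monotone fun i => I.lpRadius z (order i) :=
    Tuple.monotone_sort (I.lpRadius z ∘ e.symm)
  obtain ⟨chosen, hchosen⟩ := exists_greedy_set (fun x => (order.symm x : ℕ))
    fun x x' => Disjoint (B x) (B x')
  have hdisj : Pairwise fun x x' : chosen => Disjoint (B x) (B x') := by
    intro x x' hne
    rcases lt_trichotomy (order.symm x'.1) (order.symm x.1) with hlt | heq | hlt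
    · exact (hchosen x).1 x.2 x' x'.2 hlt
    · exact absurd (Subtype.ext (order.symm.injective heq)).symm hne
    · exact ((hchosen x').1 x'.2 x x.2 hlt).symm
  have hsum : ∑ p, wt p = N * (1 / β) := by
    rw [← Finset.sum_fiberwise Finset.univ loc, Finset.sum_congr rfl fun c _ => hloc c, h.sum_y,
      ← hN]
    field_simp
  obtain ⟨n', π, wt', G, hwt', hπ, hG, hGB⟩ := exists_split_groups hwt (one_div_pos.2 hβ0) hsum
    (fun x : chosen => hBw x) hdisj
  have hπs : Function.Surjective π := by
    intro p
    have h1 := hπ fun p' => p' = p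
    have h2 : 0 < ∑ p' with p' = p, wt p' := Finset.sum_pos (fun p' _ => hwt p') ⟨p, by simp⟩
    obtain ⟨q, hq, -⟩ := Finset.exists_ne_zero_of_sum_ne_zero (h1.trans_ne h2.ne')
    exact ⟨q, (Finset.mem_filter.1 hq).2⟩
  let pre : Finset (Fin n) → Finset (Fin n') := fun T => Finset.univ.filter (π · ∈ T)
  have hpre : ∀ T T', Disjoint (pre T) (pre T') ↔ Disjoint T T' := by
    intro T T'
    simp only [Finset.disjoint_left, pre, Finset.mem_filter, Finset.mem_univ, true_and]
    exact (hπs.forall (p := fun p => p ∈ T → p ∉ T')).symm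
  have hwit : ∀ x, x ∉ chosen → ∃ w ∈ chosen, ¬ Disjoint (B x) (B w) ∧
      ∀ x' ∈ chosen, ¬ Disjoint (B x) (B x') → order.symm w ≤ order.symm x' := by
    intro x hx
    rw [hchosen] at hx
    push Not at hx
    obtain ⟨x₁, h1, -, h2⟩ := hx
    obtain ⟨w, hw, hmin⟩ := Finset.exists_min_image
      (Finset.univ.filter fun x' => x' ∈ chosen ∧ ¬ Disjoint (B x) (B x')) order.symm
      ⟨x₁, by simp [h1, h2]⟩
    simp only [Finset.mem_filter, Finset.mem_univ, true_and] at hw hmin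
    exact ⟨w, hw.1, hw.2, fun x' h3 h4 => hmin x' ⟨h3, h4⟩⟩
  choose! w hw1 hw2 hw3 using hwit
  exact ⟨{
    one_lt_beta := hβ
    n := n'
    loc := loc ∘ π
    wt := wt'
    wt_pos := hwt'
    sum_wt := fun c => (hπ fun p => loc p = c).trans (hloc c)
    serve := fun x => pre (S (Sum.inl x))
    sum_serve := fun x c => by
      have h1 := hπ fun p => p ∈ S (Sum.inl x) ∧ loc p = c
      have h2 : ∑ p ∈ S (Sum.inl x) with loc p = c, wt p = z x c := hS (Sum.inl x) c
      rw [Finset.filter_filter]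
      refine h1.trans (Eq.trans ?_ h2)
      refine Finset.sum_congr ?_ fun _ _ => rfl
      ext p
      simp
    ball := fun x => pre (B x)
    ball_weight := fun x => by
      refine (hπ fun p => p ∈ B x).trans (Eq.trans ?_ (hBw x))
      refine Finset.sum_congr ?_ fun _ _ => rfl
      ext p
      simp
    ball_closest := fun x p hp q hq => by
      simp only [pre, Finset.mem_filter, Finset.mem_univ, true_and] at hp hq
      exact hBd x _ hp _ hq
    order := order
    order_mono := horder
    chosen := chosen
    mem_chosen_iff := fun x => by
      simp only [hpre]
      exact hchosen x
    witness := fun x => if x ∈ chosen then x else w x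
    witness_of_chosen := fun x hx => if_pos hx
    witness_of_discarded := fun x hx => by
      simp only [hpre, if_neg hx]
      exact ⟨hw1 x hx, hw2 x hx, hw3 x hx⟩
    groups := G
    group_weight := hG
    ball_mem_groups := fun x hx => hGB ⟨x, hx⟩ }⟩

end RelaxedKMedian

namespace RelaxedKMedian

variable {X C : Type*} [Fintype X] [Fintype C] [DecidableEq C]

namespace Execution

variable {I : RelaxedKMedian X C} {β : ℝ} {y : C → ℝ} {z : X → C → ℝ}

/-! ### Groups and picks -/

lemma beta_pos (E : I.Execution β y z) : 0 < β := zero_lt_one.trans E.one_lt_beta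

lemma sum_groups (E : I.Execution β y z) (f : Fin E.n → ℝ) :
    ∑ g : E.groups.parts, ∑ p ∈ g.1, f p = ∑ p, f p := by
  rw [Finset.sum_coe_sort E.groups.parts fun g => ∑ p ∈ g, f p]
  conv_rhs => rw [← E.groups.biUnion_parts]
  exact (Finset.sum_biUnion fun _ hg _ hg' hne => E.groups.disjoint hg hg' hne).symm

lemma card_groups (E : I.Execution β y z) (h : I.LPFeasible y z) :
    (E.groups.parts.card : ℝ) = β * I.k := by
  have h1 : ∑ p, E.wt p = I.k := by
    rw [← h.sum_y, ← Finset.sum_fiberwise Finset.univ E.loc]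
    exact Finset.sum_congr rfl fun c _ => E.sum_wt c
  have h2 := E.sum_groups E.wt
  rw [Finset.sum_congr rfl fun g _ => E.group_weight g.1 g.2, h1] at h2
  have hβ := E.beta_pos
  simp only [Finset.sum_const, Finset.card_univ, Fintype.card_coe, nsmul_eq_mul] at h2
  rw [← h2]
  field_simp

/-- The expectation of `f` at the copy picked in the group `g`. -/
noncomputable def mean (E : I.Execution β y z) (g : E.groups.parts) (f : Fin E.n → ℝ) : ℝ :=
  ∑ p ∈ g.1, β * E.wt p * f p

lemma integral_pick (E : I.Execution β y z) (g : E.groups.parts) (f : Fin E.n → ℝ) :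
    ∫ p, f p ∂(E.pick g).toMeasure = E.mean g f := by
  rw [PMF.integral_eq_sum, mean, ← Finset.sum_filter_add_sum_filter_not Finset.univ (· ∈ g.1),
    Finset.filter_mem_eq_inter, Finset.univ_inter, Finset.sum_eq_zero (s := Finset.filter _ _),
    add_zero]
  · refine Finset.sum_congr rfl fun p hp => ?_
    rw [pick, PMF.ofFintype_apply, if_pos hp,
      ENNReal.toReal_ofReal (mul_pos E.beta_pos (E.wt_pos p)).le, smul_eq_mul]
  · intro p hp
    rw [pick, PMF.ofFintype_apply, if_neg (Finset.mem_filter.1 hp).2]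
    simp

instance isProbabilityMeasure_law (E : I.Execution β y z) : IsProbabilityMeasure E.law := by
  unfold law
  infer_instance

lemma integral_law_prod (E : I.Execution β y z) (f : E.groups.parts → Fin E.n → ℝ) :
    ∫ s, ∏ g, f g (s g) ∂E.law = ∏ g, E.mean g (f g) := by
  rw [law, integral_fintype_prod_eq_prod]
  exact Finset.prod_congr rfl fun g _ => E.integral_pick g (f g)

lemma integrable_law (E : I.Execution β y z) (f : (E.groups.parts → Fin E.n) → ℝ) :
    Integrable f E.law := Integrable.of_finite

lemma mean_mono (E : I.Execution β y z) (g : E.groups.parts) {f f' : Fin E.n → ℝ}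
    (h : ∀ p ∈ g.1, f p ≤ f' p) : E.mean g f ≤ E.mean g f' :=
  Finset.sum_le_sum fun p hp =>
    mul_le_mul_of_nonneg_left (h p hp) (mul_pos E.beta_pos (E.wt_pos p)).le

lemma mean_const (E : I.Execution β y z) (g : E.groups.parts) (c : ℝ) :
    E.mean g (fun _ => c) = c := by
  have hβ := E.beta_pos
  rw [mean, ← Finset.sum_mul, ← Finset.mul_sum, E.group_weight g.1 g.2, mul_one_div_cancel hβ.ne',
    one_mul]

lemma mean_add (E : I.Execution β y z) (g : E.groups.parts) (f f' : Fin E.n → ℝ) :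
    E.mean g (fun p => f p + f' p) = E.mean g f + E.mean g f' := by
  simp only [mean, mul_add, Finset.sum_add_distrib]

lemma mean_sub (E : I.Execution β y z) (g : E.groups.parts) (f f' : Fin E.n → ℝ) :
    E.mean g (fun p => f p - f' p) = E.mean g f - E.mean g f' := by
  simp only [mean, mul_sub, Finset.sum_sub_distrib]

lemma mean_mul_const (E : I.Execution β y z) (g : E.groups.parts) (f : Fin E.n → ℝ) (c : ℝ) :
    E.mean g (fun p => f p * c) = E.mean g f * c := by
  simp only [mean, Finset.sum_mul, mul_assoc]

/-! ### Balls and witnesses -/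

lemma sum_serve_mul (E : I.Execution β y z) (x : X) (f : C → ℝ) :
    ∑ p ∈ E.serve x, E.wt p * f (E.loc p) = ∑ c, z x c * f c := by
  rw [← Finset.sum_fiberwise (E.serve x) E.loc]
  refine Finset.sum_congr rfl fun c _ => ?_
  rw [← E.sum_serve x c, Finset.sum_mul]
  exact Finset.sum_congr rfl fun p hp => by rw [(Finset.mem_filter.1 hp).2]

lemma sum_serve_wt (E : I.Execution β y z) (h : I.LPFeasible y z) (x : X) :
    ∑ p ∈ E.serve x, E.wt p = 1 := by
  simpa [h.sum_z] using E.sum_serve_mul x fun _ => 1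

/-- The LP radius dominates the distance sum of a ball plus the radius `r` of the ball times the
remaining weight `1 - 1 / β` (here multiplied by `β`): trading serving copies outside the ball for
copies inside it only brings the weight closer. -/
lemma exists_ball_radius (E : I.Execution β y z) (h : I.LPFeasible y z) (x : X) :
    ∃ r, (∀ p ∈ E.ball x, I.d x (E.loc p) ≤ r) ∧
      ∑ p ∈ E.ball x, β * E.wt p * I.d x (E.loc p) + (β - 1) * r ≤ β * I.lpRadius z x := by
  classical
  have hβ := E.beta_pos
  have hne : (E.ball x).Nonempty := by
    rw [Finset.nonempty_iff_ne_empty]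
    intro h0
    have := E.ball_weight x
    rw [h0, Finset.sum_empty] at this
    exact (one_div_pos.2 hβ).ne this
  obtain ⟨p₀, hp₀, hmax⟩ := Finset.exists_max_image (E.ball x) (fun p => I.d x (E.loc p)) hne
  set r := I.d x (E.loc p₀)
  refine ⟨r, hmax, ?_⟩
  -- The excess over `r` is nonpositive in the ball and nonnegative outside.
  have key : ∑ p ∈ E.ball x, E.wt p * (I.d x (E.loc p) - r) ≤
      ∑ p ∈ E.serve x, E.wt p * (I.d x (E.loc p) - r) := by
    rw [← Finset.sum_inter_add_sum_sdiff (E.ball x) (E.serve x),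
      ← Finset.sum_inter_add_sum_sdiff (E.serve x) (E.ball x), Finset.inter_comm]
    have h1 : ∑ p ∈ E.ball x \ E.serve x, E.wt p * (I.d x (E.loc p) - r) ≤ 0 :=
      Finset.sum_nonpos fun p hp => mul_nonpos_of_nonneg_of_nonpos (E.wt_pos p).le
        (sub_nonpos.2 (hmax p (Finset.mem_sdiff.1 hp).1))
    have h2 : 0 ≤ ∑ p ∈ E.serve x \ E.ball x, E.wt p * (I.d x (E.loc p) - r) :=
      Finset.sum_nonneg fun p hp => mul_nonneg (E.wt_pos p).le
        (sub_nonneg.2 (E.ball_closest x p₀ hp₀ p (Finset.mem_sdiff.1 hp).2))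
    linarith
  simp only [mul_sub, Finset.sum_sub_distrib, ← Finset.sum_mul, E.sum_serve_wt h, E.ball_weight,
    E.sum_serve_mul x (I.d x)] at key
  have h3 := mul_le_mul_of_nonneg_left key hβ.le
  have h4 : ∑ p ∈ E.ball x, β * E.wt p * I.d x (E.loc p) =
      β * ∑ p ∈ E.ball x, E.wt p * I.d x (E.loc p) := by
    simp only [Finset.mul_sum, mul_assoc]
  have h5 : β * (∑ p ∈ E.ball x, E.wt p * I.d x (E.loc p) - 1 / β * r) =
      β * (∑ p ∈ E.ball x, E.wt p * I.d x (E.loc p)) - r := by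
    field_simp
  rw [h4, lpRadius]
  linarith

lemma witness_mem (E : I.Execution β y z) (x : X) : E.witness x ∈ E.chosen := by
  by_cases hx : x ∈ E.chosen
  · rwa [E.witness_of_chosen x hx]
  · exact (E.witness_of_discarded x hx).1

lemma ball_inter_witness (E : I.Execution β y z) (x : X) :
    ∃ p, p ∈ E.ball x ∧ p ∈ E.ball (E.witness x) := by
  by_cases hx : x ∈ E.chosen
  · rw [E.witness_of_chosen x hx]
    have hne : ∑ p ∈ E.ball x, E.wt p ≠ 0 := by
      rw [E.ball_weight]
      exact (one_div_pos.2 E.beta_pos).ne'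
    obtain ⟨p, hp, -⟩ := Finset.exists_ne_zero_of_sum_ne_zero hne
    exact ⟨p, hp, hp⟩
  · exact Finset.not_disjoint_iff.1 (E.witness_of_discarded x hx).2.1

lemma lpRadius_witness_le (E : I.Execution β y z) (x : X) :
    I.lpRadius z (E.witness x) ≤ I.lpRadius z x := by
  by_cases hx : x ∈ E.chosen
  · rw [E.witness_of_chosen x hx]
  · have hx' := hx
    rw [E.mem_chosen_iff] at hx'
    push Not at hx'
    obtain ⟨x₁, h1, h2, h3⟩ := hx'
    have := E.order_mono (((E.witness_of_discarded x hx).2.2 x₁ h1 h3).trans h2.le)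
    simpa using this

end Execution

end RelaxedKMedian

namespace RelaxedKMedian

variable {X C : Type*} [Fintype X] [Fintype C] [DecidableEq C]

namespace Execution

variable {I : RelaxedKMedian X C} {β : ℝ} {y : C → ℝ} {z : X → C → ℝ}

/-! ### The expected distance of a point -/

/-- The indicator function of the copies that serve `x`. -/
noncomputable def hit (E : I.Execution β y z) (x : X) (p : Fin E.n) : ℝ :=
  if p ∈ E.serve x then 1 else 0

lemma hit_nonneg (E : I.Execution β y z) (x : X) (p : Fin E.n) : 0 ≤ E.hit x p := by
  unfold hit; positivity

lemma one_sub_hit_nonneg (E : I.Execution β y z) (x : X) (p : Fin E.n) : 0 ≤ 1 - E.hit x p := by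
  unfold hit; split_ifs <;> norm_num

lemma mean_one_sub_hit (E : I.Execution β y z) (g : E.groups.parts) (x : X) :
    E.mean g (fun p => 1 - E.hit x p) = 1 - E.mean g (E.hit x) := by
  rw [mean_sub, mean_const]

lemma mean_hit_nonneg (E : I.Execution β y z) (g : E.groups.parts) (x : X) :
    0 ≤ E.mean g (E.hit x) :=
  (E.mean_const g 0).symm.trans_le (E.mean_mono g fun p _ => E.hit_nonneg x p)

lemma mean_hit_le_one (E : I.Execution β y z) (g : E.groups.parts) (x : X) :
    E.mean g (E.hit x) ≤ 1 :=
  (E.mean_mono g fun p _ => sub_nonneg.1 (E.one_sub_hit_nonneg x p)).trans_eq (E.mean_const g 1)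

lemma sum_mean_hit_mul (E : I.Execution β y z) (x : X) (f : C → ℝ) :
    ∑ g, E.mean g (fun p => E.hit x p * f (E.loc p)) = β * ∑ c, z x c * f c := by
  simp only [mean]
  rw [E.sum_groups fun p => β * E.wt p * (E.hit x p * f (E.loc p)), ← E.sum_serve_mul,
    Finset.mul_sum, ← Finset.sum_subset (Finset.subset_univ (E.serve x))]
  · exact Finset.sum_congr rfl fun p hp => by rw [hit, if_pos hp]; ring
  · intro p _ hp
    rw [hit, if_neg hp]; ring

lemma sum_mean_hit (E : I.Execution β y z) (h : I.LPFeasible y z) (x : X) :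
    ∑ g, E.mean g (E.hit x) = β := by
  simpa [h.sum_z] using E.sum_mean_hit_mul x fun _ => 1

/-- Whatever the ranking `e` of the groups and the fallback group `b`, a point can go to the copy
picked in the first group that hits a serving copy, or to the copy picked in `b` if there is no
such group. The bound is a sum of products of functions of the independent picks. -/
lemma distTo_output_le (E : I.Execution β y z) (x : X) {m : ℕ} (e : Fin m ≃ E.groups.parts)
    (b : E.groups.parts) (s : E.groups.parts → Fin E.n) :
    I.distTo x (E.output s) ≤
      ∑ i, ∏ g, (if e.symm g < i then 1 - E.hit x (s g) else 1) *
          (if g = e i then E.hit x (s g) * I.d x (E.loc (s g)) else 1) +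
        ∏ g, (1 - E.hit x (s g)) * (if g = b then I.d x (E.loc (s g)) else 1) := by
  have hle : ∀ g, I.distTo x (E.output s) ≤ I.d x (E.loc (s g)) := fun g =>
    I.distTo_le x (Finset.mem_image_of_mem _ (Finset.mem_univ g))
  have hnn : ∀ i, 0 ≤ ∏ g, (if e.symm g < i then 1 - E.hit x (s g) else 1) *
      (if g = e i then E.hit x (s g) * I.d x (E.loc (s g)) else 1) := by
    intro i
    refine Finset.prod_nonneg fun g _ => mul_nonneg ?_ ?_
    · split_ifs
      exacts [E.one_sub_hit_nonneg x _, zero_le_one]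
    · split_ifs
      exacts [mul_nonneg (E.hit_nonneg x _) (I.d_nonneg _ _), zero_le_one]
  have hnn' : 0 ≤ ∏ g, (1 - E.hit x (s g)) * (if g = b then I.d x (E.loc (s g)) else 1) := by
    refine Finset.prod_nonneg fun g _ => mul_nonneg (E.one_sub_hit_nonneg x _) ?_
    split_ifs
    exacts [I.d_nonneg _ _, zero_le_one]
  by_cases hex : ∃ i, s (e i) ∈ E.serve x
  · obtain ⟨i, hi, hmin⟩ := WellFounded.has_min (wellFounded_lt (α := Fin m))
      {i | s (e i) ∈ E.serve x} hex
    refine le_add_of_le_of_nonneg ?_ hnn'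
    refine le_trans ?_ (Finset.single_le_sum (fun i _ => hnn i) (Finset.mem_univ i))
    rw [Finset.prod_eq_single (e i)]
    · have hi' : s (e i) ∈ E.serve x := hi
      simpa [hit, hi'] using hle (e i)
    · intro g _ hg
      rw [if_neg hg, mul_one]
      split_ifs with hlt
      · have : s g ∉ E.serve x := fun hmem => hmin (e.symm g) (by simpa using hmem) hlt
        simp [hit, this]
      · rfl
    · simp
  · push Not at hex
    refine le_add_of_nonneg_of_le (Finset.sum_nonneg fun i _ => hnn i) ?_
    have hs : ∀ g, s g ∉ E.serve x := fun g => by simpa using hex (e.symm g)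
    simpa [hit, hs] using hle b

/-- The expected distance of a point, split into the cases that its set of serving copies is hit
or not. -/
lemma integral_distTo_le (E : I.Execution β y z) (h : I.LPFeasible y z) (x : X)
    (b : E.groups.parts) :
    ∫ s, I.distTo x (E.output s) ∂E.law ≤
      (1 - ∏ g, (1 - E.mean g (E.hit x))) * I.lpRadius z x +
        (∏ g ∈ Finset.univ.erase b, (1 - E.mean g (E.hit x))) *
          E.mean b (fun p => (1 - E.hit x p) * I.d x (E.loc p)) := by
  classical
  -- `q` and `a` are the hitting probability of a group and the average distance of its hits.
  set q : E.groups.parts → ℝ := fun g => E.mean g (E.hit x)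
  set t : E.groups.parts → ℝ := fun g => E.mean g (fun p => E.hit x p * I.d x (E.loc p))
  set a : E.groups.parts → ℝ := fun g => t g / q g
  have hqa : ∀ g, q g * a g = t g := by
    intro g
    rcases eq_or_ne (q g) 0 with h0 | h0
    · have h1 : ∀ p ∈ g.1, β * E.wt p * E.hit x p = 0 := by
        refine (Finset.sum_eq_zero_iff_of_nonneg fun p _ => ?_).1 h0
        exact mul_nonneg (mul_pos E.beta_pos (E.wt_pos p)).le (E.hit_nonneg x p)
      have h2 : t g = 0 := Finset.sum_eq_zero fun p hp => by
        rw [← mul_assoc, h1 p hp, zero_mul]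
      rw [h0, h2, zero_mul]
    · exact mul_div_cancel₀ _ h0
  obtain ⟨e, he⟩ : ∃ e : Fin (Fintype.card E.groups.parts) ≃ E.groups.parts, Monotone (a ∘ e) :=
    ⟨(Tuple.sort (a ∘ (Fintype.equivFin _).symm)).trans (Fintype.equivFin _).symm,
      Tuple.monotone_sort (a ∘ (Fintype.equivFin _).symm)⟩
  have hterm : ∀ i, ∏ g, E.mean g (fun p => (if e.symm g < i then 1 - E.hit x p else 1) *
      (if g = e i then E.hit x p * I.d x (E.loc p) else 1)) =
        q (e i) * (∏ j with j < i, (1 - q (e j))) * a (e i) := by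
    intro i
    rw [mul_right_comm, hqa, mul_comm (t _), Finset.prod_filter, ← Equiv.prod_comp e]
    have hlast : t (e i) = ∏ j, if j = i then t (e j) else 1 := by simp
    rw [hlast, ← Finset.prod_mul_distrib]
    refine Finset.prod_congr rfl fun j _ => ?_
    simp only [Equiv.symm_apply_apply, EmbeddingLike.apply_eq_iff_eq]
    rcases lt_trichotomy j i with hlt | rfl | hlt
    · simp only [hlt, hlt.ne, if_true, if_false, mul_one]
      exact E.mean_one_sub_hit _ _
    · simp only [lt_irrefl, if_true, if_false, one_mul]
      rfl
    · simp only [hlt.not_gt, hlt.ne', if_false, mul_one, mean_const]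
  have hlast : ∏ g, E.mean g (fun p => (1 - E.hit x p) * (if g = b then I.d x (E.loc p) else 1)) =
      (∏ g ∈ Finset.univ.erase b, (1 - q g)) *
        E.mean b (fun p => (1 - E.hit x p) * I.d x (E.loc p)) := by
    rw [← Finset.prod_erase_mul _ _ (Finset.mem_univ b)]
    congr 1
    · refine Finset.prod_congr rfl fun g hg => ?_
      simp only [Finset.ne_of_mem_erase hg, if_false, mul_one]
      exact E.mean_one_sub_hit _ _
    · simp
  have hcheb : ∑ i, q (e i) * (∏ j with j < i, (1 - q (e j))) * a (e i) ≤
      (1 - ∏ g, (1 - q g)) * I.lpRadius z x := by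
    have hanti : Antitone fun i => ∏ j with j < i, (1 - q (e j)) := by
      intro i i' hii
      refine Finset.prod_le_prod_of_subset_of_le_one
        (fun j hj => ?_) (fun j _ => sub_nonneg.2 (E.mean_hit_le_one _ x))
        (fun j _ _ => sub_le_self _ (E.mean_hit_nonneg _ x))
      simp only [Finset.mem_filter, Finset.mem_univ, true_and] at hj ⊢
      exact hj.trans_le hii
    have h1 := sum_mul_mul_sum_le (fun i => E.mean_hit_nonneg (e i) x) hanti he
    have h2 : ∑ i, q (e i) = β := (Equiv.sum_comp e q).trans (E.sum_mean_hit h x)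
    have h3 : ∑ i, q (e i) * a (e i) = β * I.lpRadius z x := by
      rw [Equiv.sum_comp e fun g => q g * a g, Finset.sum_congr rfl fun g _ => hqa g]
      exact E.sum_mean_hit_mul x (I.d x)
    have h4 : ∑ i, q (e i) * (∏ j with j < i, (1 - q (e j))) = 1 - ∏ g, (1 - q g) := by
      rw [← Equiv.prod_comp e, Finset.prod_one_sub_ordered, sub_sub_cancel]
    change (∑ i, q (e i) * (∏ j with j < i, (1 - q (e j))) * a (e i)) * (∑ i, q (e i)) ≤
      (∑ i, q (e i) * (∏ j with j < i, (1 - q (e j)))) * ∑ i, q (e i) * a (e i) at h1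
    rw [h2, h3, h4] at h1
    refine le_of_mul_le_mul_right (h1.trans_eq ?_) E.beta_pos
    ring
  refine (integral_mono (E.integrable_law _) (E.integrable_law _)
    (E.distTo_output_le x e b)).trans ?_
  rw [integral_add (E.integrable_law _) (E.integrable_law _),
    integral_finsetSum _ fun _ _ => E.integrable_law _]
  refine add_le_add (le_trans (le_of_eq ?_) hcheb) (le_of_eq ?_)
  · refine Finset.sum_congr rfl fun i _ => ?_
    rw [← hterm]
    exact E.integral_law_prod fun g p => (if e.symm g < i then 1 - E.hit x p else 1) *
      (if g = e i then E.hit x p * I.d x (E.loc p) else 1)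
  · rw [← hlast]
    exact E.integral_law_prod fun g p =>
      (1 - E.hit x p) * (if g = b then I.d x (E.loc p) else 1)

/-- The expected distance of a point is at most `approxFactor β` times its LP radius. If no serving
copy is hit, the point is sent to the copy picked in the ball of its witness. -/
lemma integral_distTo_le_approxFactor (E : I.Execution β y z) (h : I.LPFeasible y z) (x : X) :
    ∫ s, I.distTo x (E.output s) ∂E.law ≤ approxFactor β * I.lpRadius z x := by
  classical
  set x' := E.witness x
  set b : E.groups.parts := ⟨E.ball x', E.ball_mem_groups x' (E.witness_mem x)⟩
  obtain ⟨r, hr, hrR⟩ := E.exists_ball_radius h x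
  obtain ⟨r', hr', hrR'⟩ := E.exists_ball_radius h x'
  obtain ⟨p₀, hp₀, hp₀'⟩ := E.ball_inter_witness x
  have hβ := E.beta_pos
  set q : E.groups.parts → ℝ := fun g => E.mean g (E.hit x)
  set m := E.mean b (fun p => (1 - E.hit x p) * I.d x' (E.loc p))
  set Po := ∏ g ∈ Finset.univ.erase b, (1 - q g)
  have hR := lpRadius_nonneg h x
  have hRle := mul_le_mul_of_nonneg_left (E.lpRadius_witness_le x) hβ.le
  have ha0 : 0 ≤ ∑ p ∈ E.ball x, β * E.wt p * I.d x (E.loc p) :=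
    Finset.sum_nonneg fun p _ =>
      mul_nonneg (mul_pos hβ (E.wt_pos p)).le (I.d_nonneg _ _)
  have hP : ∏ g, (1 - q g) = Po * (1 - q b) :=
    (Finset.prod_erase_mul _ _ (Finset.mem_univ b)).symm
  have hPo0 : 0 ≤ Po := Finset.prod_nonneg fun g _ => sub_nonneg.2 (E.mean_hit_le_one g x)
  have hPo1 : Po ≤ Real.exp (-(β - q b)) := by
    have hsum : ∑ g ∈ Finset.univ.erase b, -q g = -(β - q b) := by
      have h1 : ∑ g, q g = β := E.sum_mean_hit h x
      have h2 := Finset.sum_erase_add Finset.univ q (Finset.mem_univ b)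
      rw [Finset.sum_neg_distrib]
      linarith
    rw [← hsum, Real.exp_sum]
    exact Finset.prod_le_prod (fun g _ => sub_nonneg.2 (E.mean_hit_le_one g x))
      fun g _ => Real.one_sub_le_exp_neg _
  have hmiss : E.mean b (fun p => 1 - E.hit x p) = 1 - q b := E.mean_one_sub_hit b x
  have hm0 : 0 ≤ m := by
    rw [← E.mean_const b 0]
    exact E.mean_mono b fun p _ => mul_nonneg (E.one_sub_hit_nonneg x p) (I.d_nonneg _ _)
  have hma : m ≤ E.mean b (fun p => I.d x' (E.loc p)) :=
    E.mean_mono b fun p _ => mul_le_of_le_one_left (I.d_nonneg _ _)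
      (sub_le_self _ (E.hit_nonneg x p))
  have hmu : m ≤ (1 - q b) * r' := by
    rw [← hmiss, ← mean_mul_const]
    exact E.mean_mono b fun p hp =>
      mul_le_mul_of_nonneg_left (hr' p hp) (E.one_sub_hit_nonneg x p)
  -- The 3-hop inequality goes through a common copy of the two balls.
  have hfall : E.mean b (fun p => (1 - E.hit x p) * I.d x (E.loc p)) ≤
      3 * ((1 - q b) * (r + r') + m) := by
    calc E.mean b (fun p => (1 - E.hit x p) * I.d x (E.loc p))
        ≤ E.mean b (fun p => (1 - E.hit x p) * (3 * (r + r')) +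
            (1 - E.hit x p) * I.d x' (E.loc p) * 3) := by
          refine E.mean_mono b fun p _ => ?_
          have h1 := I.relaxed_triangle x (E.loc p₀) x' (E.loc p)
          have h2 : I.d x (E.loc p) ≤ 3 * (r + r') + I.d x' (E.loc p) * 3 := by
            linarith [hr p₀ hp₀, hr' p₀ hp₀']
          refine (mul_le_mul_of_nonneg_left h2 (E.one_sub_hit_nonneg x p)).trans_eq ?_
          ring
      _ = _ := by
          rw [mean_add, mean_mul_const, mean_mul_const, hmiss]
          ring
  have hexc := excess_le (r := r) (r' := r') (a := E.mean b (fun p => I.d x' (E.loc p)))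
    (u := q b) E.one_lt_beta hR (by linarith) (hrR'.trans hRle) hma hm0 hmu
    (E.mean_hit_nonneg b x) (E.mean_hit_le_one b x) hPo0 hPo1
  refine (E.integral_distTo_le h x b).trans ?_
  change (1 - ∏ g, (1 - q g)) * I.lpRadius z x + Po * _ ≤ _
  have h5 := mul_le_mul_of_nonneg_left hfall hPo0
  rw [hP, approxFactor, add_mul, one_mul]
  linarith

lemma expectedCost_le (E : I.Execution β y z) (h : I.LPFeasible y z) :
    E.expectedCost ≤ approxFactor β * I.lpObjective z := by
  unfold expectedCost cost
  rw [integral_finsetSum _ fun _ _ => E.integrable_law _, lpObjective_eq_sum_lpRadius,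
    Finset.mul_sum]
  exact Finset.sum_le_sum fun x _ => E.integral_distTo_le_approxFactor h x

end Execution

end RelaxedKMedian

/-! ### The bi-criteria guarantee -/

theorem mainTheorem1 {X C : Type*} [Fintype X] [Fintype C] [Nonempty C] [DecidableEq C]
    (I : RelaxedKMedian X C) (β : ℝ) (hβ : 1 < β) (β' : ℝ)
    (hβ' : β' = (⌈β * (I.k : ℝ)⌉₊ : ℝ) / (I.k : ℝ)) :
    (∃ (y : C → ℝ) (z : X → C → ℝ), I.LPOptimal y z) ∧
    ∀ (y : C → ℝ) (z : X → C → ℝ), I.LPOptimal y z →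
      Nonempty (I.Execution β' y z) ∧
      ∀ E : I.Execution β' y z,
        E.groups.parts.card = ⌈β * (I.k : ℝ)⌉₊ ∧
        (∀ s : E.groups.parts → Fin E.n,
          (E.output s).Nonempty ∧ (E.output s).card ≤ ⌈β * (I.k : ℝ)⌉₊) ∧
        E.expectedCost ≤ approxFactor β * I.lpObjective z ∧
        ∀ S : Finset C, S.Nonempty → S.card ≤ I.k →
          E.expectedCost ≤ approxFactor β * I.cost S := by
  have hk : (0 : ℝ) < I.k := by exact_mod_cast I.k_pos
  have hN : β' * I.k = (⌈β * (I.k : ℝ)⌉₊ : ℝ) := by rw [hβ', div_mul_cancel₀ _ hk.ne']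
  have hββ' : β ≤ β' := by
    rw [hβ', le_div_iff₀ hk]
    exact Nat.le_ceil _
  have hNpos : 0 < ⌈β * (I.k : ℝ)⌉₊ := Nat.ceil_pos.2 (by positivity)
  refine ⟨I.exists_LPOptimal, fun y z hopt =>
    ⟨RelaxedKMedian.nonempty_execution (hβ.trans_le hββ') hN hopt.1, fun E => ?_⟩⟩
  have hcard : E.groups.parts.card = ⌈β * (I.k : ℝ)⌉₊ := by
    exact_mod_cast (E.card_groups hopt.1).trans hN
  have hR : 0 ≤ I.lpObjective z := by
    rw [I.lpObjective_eq_sum_lpRadius]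
    exact Finset.sum_nonneg fun x _ => RelaxedKMedian.lpRadius_nonneg hopt.1 x
  have hcost : E.expectedCost ≤ approxFactor β * I.lpObjective z :=
    (E.expectedCost_le hopt.1).trans
      (mul_le_mul_of_nonneg_right (approxFactor_antitone hβ hββ') hR)
  refine ⟨hcard, fun s => ⟨?_, ?_⟩, hcost, fun S hS hSk => hcost.trans ?_⟩
  · obtain ⟨g, hg⟩ := Finset.card_pos.1 (hcard ▸ hNpos)
    exact ⟨_, Finset.mem_image_of_mem _ (Finset.mem_univ ⟨g, hg⟩)⟩
  · refine Finset.card_image_le.trans_eq ?_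
    rw [Finset.card_univ, Fintype.card_coe, hcard]
  · exact mul_le_mul_of_nonneg_left (hopt.lpObjective_le_cost hS hSk) (approxFactor_nonneg hβ)
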